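/- Let $(\mathbf{C},\otimes,I,\dagger)$ be a dagger compact closed category, that is, a symmetric monoidal category with an identity-on-objects involutive contravariant functor $\dagger$ (the hom sets being sets), such that $\otimes$ preserves $\dagger$, the associators, unitors and braidings are dagger isomorphisms ($m^{-1}=m^\dagger$), and each object $X$ has a dagger dual: an object $X^*$ and a morphism $\eta_X\colon I\to X^*\otimes X$ that satisfies, together with $(\beta_{X^*,X}\circ\eta_X)^\dagger\colon X\otimes X^*\to I$, where $\beta$ is the braiding, the two triangle identities of a duality. Assume that 1. each family $\{X_\alpha\}_{\alpha\in M}$ of objects indexed by a set has a dagger biproduct, i.e., an object with morphisms $i_\alpha$ from the $X_\alpha$ that make it a coproduct, such that the morphisms $i_\alpha^\dagger$ make it a product, $i_\alpha^\dagger\circ i_\alpha$ is an identity, and $i_\beta^\dagger\circ i_\alpha=0$ for $\alpha\neq\beta$ (in particular there is a zero object, and $0$ denotes the morphism that factors through it); 2. each morphism has a kernel $k$ that is dagger monic ($k^\dagger\circ k=\mathrm{id}$); 3. $k$ and $k^\perp$ are jointly epic for each dagger kernel $k$ (a dagger monic morphism that is a kernel of some morphism), where $k^\perp$ is a dagger monic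 kernel of $k^\dagger$; 4. $I$ is not a zero object; 5. each nonzero morphism $I\to I$ is invertible; 6. $I$ is a separator. For parallel morphisms $r,s\colon X\to Y$ put $r+s=\Delta_Y^\dagger\circ(r\oplus s)\circ\Delta_X$, where $\Delta_X\colon X\to X\oplus X$ is the diagonal, and write $r\le s$ if $r+s=s$; this is a partial order with least element $0$. Let $E(X)$ be the set of atoms of $\mathbf{C}(I,X)$ (the minimal nonzero elements), and for $r\colon X\to Y$ let $E(r)=\{(x,y)\in E(X)\times E(Y)\mid y^\dagger\circ r\circ x=1\}$, where $1=\mathrm{id}_I$. Then $E$ is a functor from $\mathbf{C}$ to the category $\mathbf{Rel}$ of sets and binary relations, and it is a strong symmetric monoidal functor $(\mathbf{C},\otimes,I)\to(\mathbf{Rel},\times,\{*\})$ with the following structure maps: the isomorphism $\{*\}\to E(I)$ is the function $*\mapsto 1$, and the natural isomorphism $E(X)\times E(Y)\to E(X\otimes Y)$ is the function $(x,y)\mapsto x\otimes y$ (composed with $I\cong I\otimes I$). In particular, $1\in E(I)$, $x\otimes y\in E(X\otimes Y)$ for all $x\in E(X)$ and $y\in E(Y)$, and the function $(x,y)\mapsto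 x\otimes y$ is a bijection. -/

import Mathlib

open CategoryTheory CategoryTheory.Limits CategoryTheory.MonoidalCategory

universe v u

/-! ### The symmetric monoidal category of sets and relations, with the Cartesian product

The category is Mathlib's `RelCat`. -/

namespace RelMon

/-- The underlying set of an object of `RelCat`. -/
def El (X : RelCat.{v}) : Type v := X

/-- A set, as an object of `RelCat`. -/
def of (A : Type v) : RelCat.{v} := A

/-- A relation, as a morphism of `RelCat`. -/
def ofRel {X Y : RelCat.{v}} (R : El X → El Y → Prop) : X ⟶ Y :=
  RelCat.Hom.ofRel {p : El X × El Y | R p.1 p.2}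

/-- `x` is related to `y` by the morphism `f` of `RelCat`. -/
def Related {X Y : RelCat.{v}} (f : X ⟶ Y) (x : El X) (y : El Y) : Prop :=
  ((x, y) : El X × El Y) ∈ RelCat.Hom.rel f

theorem hom_ext {X Y : RelCat.{v}} {f g : X ⟶ Y}
    (h : ∀ (x : El X) (y : El Y), Related f x y ↔ Related g x y) : f = g := by
  apply RelCat.Hom.ext
  apply Set.ext
  rintro ⟨a, b⟩
  exact h a b

theorem related_ofRel {X Y : RelCat.{v}} (R : El X → El Y → Prop) (x : El X) (y : El Y) :
    Related (ofRel R) x y ↔ R x y := Iff.rfl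

theorem related_id {X : RelCat.{v}} (x y : El X) : Related (𝟙 X) x y ↔ x = y := Iff.rfl

theorem related_comp {X Y Z : RelCat.{v}} (f : X ⟶ Y) (g : Y ⟶ Z) (x : El X) (z : El Z) :
    Related (f ≫ g) x z ↔ ∃ y : El Y, Related f x y ∧ Related g y z := Iff.rfl

/-- A function, regarded as a morphism of `RelCat` (its graph). -/
def graphHom {X Y : RelCat.{v}} (f : El X → El Y) : X ⟶ Y := ofRel (fun x y => f x = y)

theorem graph_comp {X Y Z : RelCat.{v}} (f : El X → El Y) (g : El Y → El Z) :
    graphHom f ≫ graphHom g = graphHom (fun x => g (f x)) := by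
  apply hom_ext
  intro x z
  rw [related_comp]
  simp only [graphHom, related_ofRel]
  simp

theorem graph_id (X : RelCat.{v}) : 𝟙 X = graphHom (fun x : El X => x) := rfl

/-- A bijection, regarded as an isomorphism of `RelCat`. -/
def equivIso {X Y : RelCat.{v}} (e : El X ≃ El Y) : X ≅ Y where
  hom := graphHom e
  inv := graphHom e.symm
  hom_inv_id := by rw [graph_comp, graph_id]; simp
  inv_hom_id := by rw [graph_comp, graph_id]; simp

/-- The Cartesian product of sets, as an object of `RelCat`. -/
def prodObj (X Y : RelCat.{v}) : RelCat.{v} := of (El X × El Y)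

/-- The one-point set, as an object of `RelCat`. -/
def unitObj : RelCat.{v} := of PUnit.{v + 1}

def pair {X Y : RelCat.{v}} (x : El X) (y : El Y) : El (prodObj X Y) := (x, y)

def fst {X Y : RelCat.{v}} (p : El (prodObj X Y)) : El X := Prod.fst p

def snd {X Y : RelCat.{v}} (p : El (prodObj X Y)) : El Y := Prod.snd p

theorem pair_eta {X Y : RelCat.{v}} (p : El (prodObj X Y)) : pair (fst p) (snd p) = p := rfl

theorem prod_ext {X Y : RelCat.{v}} (p q : El (prodObj X Y)) :
    p = q ↔ fst p = fst q ∧ snd p = snd q := Prod.ext_iff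

/-- The product of two relations: `(x, x')` is related to `(y, y')` when `x` is related to `y`
and `x'` is related to `y'`. -/
def prodHom {X Y X' Y' : RelCat.{v}} (f : X ⟶ Y) (g : X' ⟶ Y') :
    prodObj X X' ⟶ prodObj Y Y' :=
  ofRel (fun p q => Related f (fst p) (fst q) ∧ Related g (snd p) (snd q))

theorem prodHom_graph {X Y X' Y' : RelCat.{v}} (f : El X → El Y) (g : El X' → El Y') :
    prodHom (graphHom f) (graphHom g) =
      graphHom (fun p : El (prodObj X X') => pair (f (fst p)) (g (snd p))) := by
  apply hom_ext
  intro p q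
  exact (prod_ext (pair (f (fst p)) (g (snd p))) q).symm

theorem prodHom_id (X Y : RelCat.{v}) : prodHom (𝟙 X) (𝟙 Y) = 𝟙 (prodObj X Y) := by
  rw [graph_id, graph_id, prodHom_graph]
  rfl

theorem prodHom_comp {X Y Z X' Y' Z' : RelCat.{v}} (f : X ⟶ Y) (g : Y ⟶ Z)
    (f' : X' ⟶ Y') (g' : Y' ⟶ Z') :
    prodHom (f ≫ g) (f' ≫ g') = prodHom f f' ≫ prodHom g g' := by
  apply hom_ext
  intro p q
  constructor
  · rintro ⟨⟨y, h1, h2⟩, ⟨y', h3, h4⟩⟩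
    exact ⟨pair y y', ⟨h1, h3⟩, ⟨h2, h4⟩⟩
  · rintro ⟨y, ⟨h1, h3⟩, ⟨h2, h4⟩⟩
    exact ⟨⟨fst y, h1, h2⟩, ⟨snd y, h3, h4⟩⟩

/-- The associator `((x, y), z) ↦ (x, (y, z))`. -/
def assocIso (X Y Z : RelCat.{v}) : prodObj (prodObj X Y) Z ≅ prodObj X (prodObj Y Z) :=
  equivIso (Equiv.prodAssoc (El X) (El Y) (El Z))

/-- The left unitor `(*, x) ↦ x`. -/
def leftUnitIso (X : RelCat.{v}) : prodObj unitObj X ≅ X :=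
  equivIso (Equiv.punitProd (El X))

/-- The right unitor `(x, *) ↦ x`. -/
def rightUnitIso (X : RelCat.{v}) : prodObj X unitObj ≅ X :=
  equivIso (Equiv.prodPUnit (El X))

/-- The braiding `(x, y) ↦ (y, x)`. -/
def swapIso (X Y : RelCat.{v}) : prodObj X Y ≅ prodObj Y X :=
  equivIso (Equiv.prodComm (El X) (El Y))

/-- Naturality of functions in relations. -/
theorem comp_graph_eq {X Y X' Y' : RelCat.{v}} (f : X ⟶ Y) (g : X' ⟶ Y')
    (e : El X ≃ El X') (d : El Y ≃ El Y')
    (h : ∀ x y, Related f x y ↔ Related g (e x) (d y)) :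
    f ≫ (equivIso d).hom = (equivIso e).hom ≫ g := by
  apply hom_ext
  intro x y
  constructor
  · rintro ⟨z, h1, h2⟩
    obtain rfl : d z = y := h2
    exact ⟨e x, rfl, (h _ _).1 h1⟩
  · rintro ⟨z, h1, h2⟩
    obtain rfl : e x = z := h1
    refine ⟨d.symm y, (h _ _).2 ?_, d.apply_symm_apply y⟩
    rwa [d.apply_symm_apply]

instance : MonoidalCategory RelCat.{v} where
  tensorObj := prodObj
  whiskerLeft X _ _ f := prodHom (𝟙 X) f
  whiskerRight f Y := prodHom f (𝟙 Y)
  tensorHom f g := prodHom f g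
  tensorUnit := unitObj
  associator := assocIso
  leftUnitor := leftUnitIso
  rightUnitor := rightUnitIso
  tensorHom_def f g := by
    rw [← prodHom_comp, Category.comp_id, Category.id_comp]
  id_tensorHom_id := prodHom_id
  tensorHom_comp_tensorHom _ _ _ _ := (prodHom_comp _ _ _ _).symm
  whiskerLeft_id := prodHom_id
  id_whiskerRight := prodHom_id
  associator_naturality _ _ _ := comp_graph_eq _ _ _ _ fun _ _ => and_assoc
  leftUnitor_naturality _ := comp_graph_eq _ _ _ _ fun _ _ =>
    ⟨fun k => k.2, fun k => ⟨rfl, k⟩⟩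
  rightUnitor_naturality _ := comp_graph_eq _ _ _ _ fun _ _ =>
    ⟨fun k => k.1, fun k => ⟨k, rfl⟩⟩
  pentagon W X Y Z := by
    simp only [assocIso, equivIso, graph_id, prodHom_graph, graph_comp]
    rfl
  triangle X Y := by
    simp only [assocIso, leftUnitIso, rightUnitIso, equivIso, graph_id, prodHom_graph, graph_comp]
    rfl

theorem hexagon_aux (X Y Z : RelCat.{v}) :
    (assocIso X Y Z).hom ≫ (swapIso X (prodObj Y Z)).hom ≫ (assocIso Y Z X).hom =
      prodHom (swapIso X Y).hom (𝟙 Z) ≫ (assocIso Y X Z).hom ≫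
        prodHom (𝟙 Y) (swapIso X Z).hom := by
  simp only [assocIso, swapIso, equivIso, graph_id, prodHom_graph, graph_comp]
  rfl

theorem hexagon_aux' (X Y Z : RelCat.{v}) :
    (assocIso X Y Z).inv ≫ (swapIso (prodObj X Y) Z).hom ≫ (assocIso Z X Y).inv =
      prodHom (𝟙 X) (swapIso Y Z).hom ≫ (assocIso X Z Y).inv ≫
        prodHom (swapIso X Z).hom (𝟙 Y) := by
  simp only [assocIso, swapIso, equivIso, graph_id, prodHom_graph, graph_comp]
  rfl

theorem swap_swap (X Y : RelCat.{v}) :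
    (swapIso X Y).hom ≫ (swapIso Y X).hom = 𝟙 (prodObj X Y) := by
  simp only [swapIso, equivIso, graph_id, graph_comp]
  rfl

instance : SymmetricCategory RelCat.{v} where
  braiding := swapIso
  braiding_naturality_right _ _ _ _ := comp_graph_eq _ _ _ _ fun _ _ => and_comm
  braiding_naturality_left _ _ := comp_graph_eq _ _ _ _ fun _ _ => and_comm
  hexagon_forward := hexagon_aux
  hexagon_reverse := hexagon_aux'
  symmetry := swap_swap

end RelMon

/-! ### Dagger categories -/

/-- A dagger category. -/
class DaggerCategory (C : Type u) [Category.{v} C] where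
  dagger : ∀ {X Y : C}, (X ⟶ Y) → (Y ⟶ X)
  dagger_id : ∀ X : C, dagger (𝟙 X) = 𝟙 X
  dagger_dagger : ∀ {X Y : C} (f : X ⟶ Y), dagger (dagger f) = f
  dagger_comp : ∀ {X Y Z : C} (f : X ⟶ Y) (g : Y ⟶ Z), dagger (f ≫ g) = dagger g ≫ dagger f

namespace DaggerCategory

/-- A symmetric monoidal category with a dagger is dagger symmetric monoidal when its product is
a dagger functor and its associators, unitors and braidings are dagger isomorphisms. -/
class DaggerSymmetricMonoidal (C : Type u) [Category.{v} C] [MonoidalCategory C]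
    [SymmetricCategory C] [DaggerCategory C] : Prop where
  dagger_tensor : ∀ {X X' Y Y' : C} (f : X ⟶ Y) (g : X' ⟶ Y'),
    dagger (f ⊗ₘ g) = dagger f ⊗ₘ dagger g
  dagger_associator : ∀ X Y Z : C, dagger (α_ X Y Z).hom = (α_ X Y Z).inv
  dagger_leftUnitor : ∀ X : C, dagger (λ_ X).hom = (λ_ X).inv
  dagger_rightUnitor : ∀ X : C, dagger (ρ_ X).hom = (ρ_ X).inv
  dagger_braiding : ∀ X Y : C, dagger (β_ X Y).hom = (β_ X Y).inv

/-- An object `X` has a dagger dual if there are an object `Xs` and `η : I ⟶ Xs ⊗ X` such that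
`η` and the dagger of `I ⟶ Xs ⊗ X ≅ X ⊗ Xs` satisfy the two triangle identities (the identities
are those of `ExactPairing`). -/
def HasDaggerDual {C : Type u} [Category.{v} C] [MonoidalCategory C]
    [SymmetricCategory C] [DaggerCategory C] (X : C) : Prop :=
  ∃ (Xs : C) (p : ExactPairing Xs X),
    p.evaluation' = dagger (p.coevaluation' ≫ (β_ Xs X).hom)

/-- A dagger compact closed category: a dagger symmetric monoidal category in which every object
has a dagger dual. -/
class DaggerCompactClosed (C : Type u) [Category.{v} C] [MonoidalCategory C]
    [SymmetricCategory C] [DaggerCategory C] : Prop extends DaggerSymmetricMonoidal C where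
  hasDaggerDual : ∀ X : C, HasDaggerDual X

section Biproducts

variable {C : Type u} [Category.{v} C]

/-- `f` is a zero morphism: it factors through a zero object. -/
def FactorsThroughZero {X Y : C} (f : X ⟶ Y) : Prop :=
  ∃ Z : C, IsZero Z ∧ ∃ (a : X ⟶ Z) (b : Z ⟶ Y), f = a ≫ b

variable [DaggerCategory C]

/-- A dagger biproduct of a family of objects: an object with injections `inj a` that make it a
coproduct, whose daggers are projections that make it a product, such that
`(inj a)† ∘ inj a` is an identity and `(inj b)† ∘ inj a` is zero for `a ≠ b`. -/
structure DaggerBiproduct {M : Type v} (F : M → C) where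
  pt : C
  inj : ∀ a : M, F a ⟶ pt
  isColimit : IsColimit (Cofan.mk pt inj)
  isLimit : IsLimit (Fan.mk pt (fun a => dagger (inj a)))
  inj_self : ∀ a : M, inj a ≫ dagger (inj a) = 𝟙 (F a)
  inj_ne : ∀ a b : M, a ≠ b → FactorsThroughZero (inj a ≫ dagger (inj b))

namespace DaggerBiproduct

/-- The morphism `⨁ r_a : ⨁ X_a ⟶ ⨁ Y_a`. -/
def map {M : Type v} {F G : M → C} (bF : DaggerBiproduct F) (bG : DaggerBiproduct G)
    (r : ∀ a, F a ⟶ G a) : bF.pt ⟶ bG.pt :=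
  Cofan.IsColimit.desc bF.isColimit (fun a => r a ≫ bG.inj a)

/-- The diagonal `X ⟶ ⨁_{a ∈ M} X`. -/
def diag {M : Type v} {X : C} (b : DaggerBiproduct (fun _ : M => X)) : X ⟶ b.pt :=
  Fan.IsLimit.lift b.isLimit (fun _ => 𝟙 X)

end DaggerBiproduct

end Biproducts

/-- Every family of objects indexed by a set has a dagger biproduct. The index sets are those
in the universe of the sets of morphisms. -/
class HasDaggerBiproducts (C : Type u) [Category.{v} C] [DaggerCategory C] : Prop where
  exists_biproduct : ∀ {M : Type v} (F : M → C), Nonempty (DaggerBiproduct F)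

section Kernels

variable {C : Type u} [Category.{v} C] [DaggerCategory C] [HasDaggerBiproducts C]

/-- A choice of dagger biproduct. -/
noncomputable def daggerBiprod {M : Type v} (F : M → C) : DaggerBiproduct F :=
  (HasDaggerBiproducts.exists_biproduct F).some

/-- The biproduct of the empty family is a zero object. -/
instance : HasZeroObject C := by
  obtain ⟨b⟩ := HasDaggerBiproducts.exists_biproduct (C := C) (M := PEmpty.{v + 1})
    (fun a => a.elim)
  refine ⟨⟨b.pt, ⟨fun Y => ⟨⟨⟨Cofan.IsColimit.desc b.isColimit (fun a => a.elim)⟩, fun f => ?_⟩⟩,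
    fun Y => ⟨⟨⟨Fan.IsLimit.lift b.isLimit (fun a => a.elim)⟩, fun f => ?_⟩⟩⟩⟩⟩
  · exact Cofan.IsColimit.hom_ext b.isColimit _ _ (fun a => a.elim)
  · exact Fan.IsLimit.hom_ext b.isLimit _ _ (fun a => a.elim)

/-- The zero morphism `X ⟶ Y` is the unique one that factors through a zero object. -/
noncomputable instance : HasZeroMorphisms C := HasZeroObject.zeroMorphismsOfZeroObject

theorem factorsThroughZero_iff {X Y : C} (f : X ⟶ Y) : FactorsThroughZero f ↔ f = 0 := by
  constructor
  · rintro ⟨Z, hZ, a, b, rfl⟩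
    rw [hZ.eq_of_tgt a 0, zero_comp]
  · rintro rfl
    exact ⟨_, isZero_zero C, 0, 0, by simp⟩

/-- The sum of a family of parallel morphisms, `Δ† ∘ (⨁ r_a) ∘ Δ`. -/
noncomputable def homSum {M : Type v} {X Y : C} (r : M → (X ⟶ Y)) : X ⟶ Y :=
  (daggerBiprod (fun _ : M => X)).diag ≫
    (daggerBiprod (fun _ : M => X)).map (daggerBiprod (fun _ : M => Y)) r ≫
      dagger (daggerBiprod (fun _ : M => Y)).diag

/-- The sum of two parallel morphisms. -/
noncomputable def homAdd {X Y : C} (r s : X ⟶ Y) : X ⟶ Y :=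
  homSum (fun i : ULift.{v} Bool => if i.down then r else s)

/-- The order on parallel morphisms: `r ≤ s` when `r + s = s`. -/
def HomLE {X Y : C} (r s : X ⟶ Y) : Prop := homAdd r s = s

/-- An atom for this order, whose least element is the zero morphism: a nonzero morphism with
nothing strictly between it and zero. -/
def IsAtomHom {X Y : C} (a : X ⟶ Y) : Prop :=
  a ≠ 0 ∧ ∀ b : X ⟶ Y, HomLE b a → b = 0 ∨ b = a

/-- `m` is dagger monic: `m† ∘ m = id`. -/
def IsDaggerMonic {X Y : C} (m : X ⟶ Y) : Prop := m ≫ dagger m = 𝟙 X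

/-- `k` is a kernel of `f`. -/
def IsKernelOf {K X Y : C} (k : K ⟶ X) (f : X ⟶ Y) : Prop :=
  ∃ w : k ≫ f = 0, Nonempty (IsLimit (KernelFork.ofι k w))

/-- A dagger kernel: a dagger monic morphism that is a kernel of some morphism. -/
def IsDaggerKernel {K X : C} (k : K ⟶ X) : Prop :=
  IsDaggerMonic k ∧ ∃ (Y : C) (f : X ⟶ Y), IsKernelOf k f

/-- `k'` is a complement `k^⊥` of `k`: a dagger kernel of `k†`. -/
def IsComplement {K K' X : C} (k' : K' ⟶ X) (k : K ⟶ X) : Prop :=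
  IsDaggerMonic k' ∧ IsKernelOf k' (dagger k)

def JointlyEpic {K K' X : C} (k : K ⟶ X) (k' : K' ⟶ X) : Prop :=
  ∀ ⦃Z : C⦄ (f g : X ⟶ Z), k ≫ f = k ≫ g → k' ≫ f = k' ≫ g → f = g

end Kernels

/-! ### The functor `E` -/

section Atoms

variable {C : Type u} [Category.{v} C] [MonoidalCategory C] [DaggerCategory C]
  [HasDaggerBiproducts C]

/-- `E(X)`: the set of atoms of `C(I, X)`. -/
def atomObj (X : C) : RelCat.{v} := RelMon.of {x : 𝟙_ C ⟶ X // IsAtomHom x}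

/-- The morphism `I ⟶ X` underlying an element of `E(X)`. -/
def atomPoint {X : C} (x : RelMon.El (atomObj X)) : 𝟙_ C ⟶ X := Subtype.val x

/-- An atom of `C(I, X)`, as an element of `E(X)`. -/
def mkAtom {X : C} (x : 𝟙_ C ⟶ X) (hx : IsAtomHom x) : RelMon.El (atomObj X) := ⟨x, hx⟩

/-- `E(r) = {(x, y) | y† ∘ r ∘ x = 1}`. -/
def atomMap {X Y : C} (r : X ⟶ Y) : atomObj X ⟶ atomObj Y :=
  RelMon.ofRel (fun x y => atomPoint x ≫ r ≫ dagger (atomPoint y) = 𝟙 (𝟙_ C))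

/-- `E` as a functor, once the functor laws hold. -/
def atomFunctor (hid : ∀ X : C, atomMap (𝟙 X) = 𝟙 (atomObj X))
    (hcomp : ∀ {X Y Z : C} (r : X ⟶ Y) (s : Y ⟶ Z), atomMap (r ≫ s) = atomMap r ≫ atomMap s) :
    C ⥤ RelCat.{v} where
  obj X := atomObj X
  map r := atomMap r
  map_id := hid
  map_comp := hcomp

/-- `x ⊗ y : I ⟶ X ⊗ Y`, through `I ≅ I ⊗ I`. -/
def tensorPoint {X Y : C} (x : 𝟙_ C ⟶ X) (y : 𝟙_ C ⟶ Y) : 𝟙_ C ⟶ X ⊗ Y :=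
  (λ_ (𝟙_ C)).inv ≫ (x ⊗ₘ y)

/-- The function `{*} → E(I)`, `* ↦ 1`, once `1` is an atom. -/
def unitAtom (h : IsAtomHom (𝟙 (𝟙_ C))) :
    RelMon.El (𝟙_ RelCat.{v}) → RelMon.El (atomObj (𝟙_ C)) :=
  fun _ => mkAtom (𝟙 (𝟙_ C)) h

/-- The function `E(X) × E(Y) → E(X ⊗ Y)`, `(x, y) ↦ x ⊗ y`, once each `x ⊗ y` is an atom. -/
def tensorAtom
    (h : ∀ {X Y : C} (x : RelMon.El (atomObj X)) (y : RelMon.El (atomObj Y)),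
      IsAtomHom (tensorPoint (atomPoint x) (atomPoint y)))
    (X Y : C) : RelMon.El (atomObj X ⊗ atomObj Y) → RelMon.El (atomObj (X ⊗ Y)) :=
  fun p => mkAtom (tensorPoint (atomPoint (RelMon.fst p)) (atomPoint (RelMon.snd p)))
    (h (RelMon.fst p) (RelMon.snd p))

end Atoms

end DaggerCategory

open DaggerCategory

/-! Biproducts give sums of arbitrary families of parallel morphisms, preserved by composition and
dagger. Infinite sums and invertibility of nonzero scalars leave only the scalars 0 and 1
(`scalar_eq_id`), with 1 + 1 = 1. Since I is a separator, a point of X is then determined by which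
points it meets, x meeting y when y† ∘ x ≠ 0, and x ≤ y means that every point meeting x meets y
(`homLE_iff`).

Kernels make this a Boolean-like geometry: a nonzero point meets itself, and points that meet have a
nonzero common lower bound (`exists_homLE_of_meets`). Hence atoms that meet are equal, and an atom
lies below every point that it meets.

The crux is that every nonzero point lies above an atom (`exists_atom_homLE`). This uses duality:
were there no atom below b, the tensor of b with its conjugate would lie below a sum of products y ⊗
s that the counit kills, although the counit does not kill that tensor.

Given atoms, E(s ∘ r) = E(s) ∘ E(r) because points that meet do so at an atom. Duality also shows
that product points detect morphisms out of X ⊗ Y (`tensor_hom_ext`), so the atoms of X ⊗ Y are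
exactly the tensors of atoms. The structure maps are graphs of functions, and coherence reduces to
identities between points. -/

namespace DaggerCategory

/-! ### Sums of parallel morphisms -/

section Sums

variable {C : Type u} [Category.{v} C] [DaggerCategory C]

theorem dagger_injective {X Y : C} {f g : X ⟶ Y} (h : dagger f = dagger g) : f = g := by
  rw [← dagger_dagger f, h, dagger_dagger]

namespace DaggerBiproduct

variable {M : Type v} {F G : M → C}

theorem inj_desc (b : DaggerBiproduct F) {Y : C} (r : ∀ a, F a ⟶ Y) (a : M) :
    b.inj a ≫ Cofan.IsColimit.desc b.isColimit r = r a :=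
  Cofan.IsColimit.fac b.isColimit r a

theorem lift_proj (b : DaggerBiproduct F) {X : C} (r : ∀ a, X ⟶ F a) (a : M) :
    Fan.IsLimit.lift b.isLimit r ≫ dagger (b.inj a) = r a :=
  Fan.IsLimit.fac b.isLimit r a

theorem desc_ext (b : DaggerBiproduct F) {Y : C} {f g : b.pt ⟶ Y}
    (h : ∀ a, b.inj a ≫ f = b.inj a ≫ g) : f = g :=
  Cofan.IsColimit.hom_ext b.isColimit _ _ h

theorem lift_ext (b : DaggerBiproduct F) {X : C} {f g : X ⟶ b.pt}
    (h : ∀ a, f ≫ dagger (b.inj a) = g ≫ dagger (b.inj a)) : f = g :=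
  Fan.IsLimit.hom_ext b.isLimit _ _ h

theorem inj_map (bF : DaggerBiproduct F) (bG : DaggerBiproduct G) (r : ∀ a, F a ⟶ G a) (a : M) :
    bF.inj a ≫ bF.map bG r = r a ≫ bG.inj a :=
  inj_desc _ _ _

theorem diag_proj {X : C} (b : DaggerBiproduct (fun _ : M => X)) (a : M) :
    b.diag ≫ dagger (b.inj a) = 𝟙 X :=
  lift_proj _ _ _

theorem inj_codiag {X : C} (b : DaggerBiproduct (fun _ : M => X)) (a : M) :
    b.inj a ≫ dagger b.diag = 𝟙 X := by
  rw [← dagger_dagger (b.inj a), ← dagger_comp, diag_proj, dagger_id]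

end DaggerBiproduct

variable [HasDaggerBiproducts C]

theorem dagger_zero (X Y : C) : dagger (0 : X ⟶ Y) = 0 := by
  rw [← factorsThroughZero_iff]
  exact ⟨_, isZero_zero C, dagger (0 : _ ⟶ Y), dagger (0 : X ⟶ _), by rw [← dagger_comp, comp_zero]⟩

theorem dagger_eq_zero_iff {X Y : C} (f : X ⟶ Y) : dagger f = 0 ↔ f = 0 := by
  constructor
  · intro h
    rw [← dagger_dagger f, h, dagger_zero]
  · rintro rfl
    exact dagger_zero _ _

namespace DaggerBiproduct

variable {M : Type v} {F G : M → C}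

theorem inj_proj_of_ne (b : DaggerBiproduct F) {i j : M} (h : i ≠ j) :
    b.inj i ≫ dagger (b.inj j) = 0 :=
  (factorsThroughZero_iff _).1 (b.inj_ne i j h)

theorem map_proj (bF : DaggerBiproduct F) (bG : DaggerBiproduct G) (r : ∀ a, F a ⟶ G a) (a : M) :
    bF.map bG r ≫ dagger (bG.inj a) = dagger (bF.inj a) ≫ r a := by
  apply bF.desc_ext
  intro c
  rw [← Category.assoc, inj_map, Category.assoc]
  by_cases h : c = a
  · subst h
    rw [inj_self, ← Category.assoc, inj_self, Category.id_comp, Category.comp_id]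
  · rw [inj_proj_of_ne _ h, ← Category.assoc, inj_proj_of_ne _ h, comp_zero,
      zero_comp]

theorem dagger_map (bF : DaggerBiproduct F) (bG : DaggerBiproduct G) (r : ∀ a, F a ⟶ G a) :
    dagger (bF.map bG r) = bG.map bF (fun a => dagger (r a)) := by
  apply bG.desc_ext
  intro a
  apply dagger_injective
  rw [dagger_comp, dagger_dagger, map_proj, inj_map, dagger_comp, dagger_dagger]

end DaggerBiproduct

open DaggerBiproduct

theorem homSum_eq {M : Type v} {X Y : C} (r : M → (X ⟶ Y)) :
    homSum r = (daggerBiprod (fun _ : M => X)).diag ≫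
      Cofan.IsColimit.desc (daggerBiprod (fun _ : M => X)).isColimit r := by
  unfold homSum
  congr 1
  apply desc_ext
  intro a
  rw [← Category.assoc, inj_map, Category.assoc, inj_codiag, Category.comp_id, inj_desc]

theorem dagger_homSum {M : Type v} {X Y : C} (r : M → (X ⟶ Y)) :
    dagger (homSum r) = homSum (fun a => dagger (r a)) := by
  unfold homSum
  rw [dagger_comp, dagger_comp, dagger_dagger, dagger_map, Category.assoc]

theorem homSum_comp {M : Type v} {X Y Z : C} (r : M → (X ⟶ Y)) (g : Y ⟶ Z) :
    homSum r ≫ g = homSum (fun a => r a ≫ g) := by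
  rw [homSum_eq, homSum_eq, Category.assoc]
  congr 1
  apply desc_ext
  intro a
  rw [← Category.assoc, inj_desc, inj_desc]

theorem comp_homSum {M : Type v} {X Y Z : C} (g : Z ⟶ X) (r : M → (X ⟶ Y)) :
    g ≫ homSum r = homSum (fun a => g ≫ r a) := by
  apply dagger_injective
  rw [dagger_comp, dagger_homSum, dagger_homSum, homSum_comp]
  simp only [dagger_comp]

theorem homSum_eq_single {M : Type v} {X Y : C} (r : M → (X ⟶ Y)) (c : M)
    (h : ∀ a, a ≠ c → r a = 0) : homSum r = r c := by
  have : Cofan.IsColimit.desc (daggerBiprod (fun _ : M => X)).isColimit r =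
      dagger ((daggerBiprod (fun _ : M => X)).inj c) ≫ r c := by
    apply desc_ext
    intro a
    rw [inj_desc, ← Category.assoc]
    by_cases hac : a = c
    · subst hac
      rw [inj_self, Category.id_comp]
    · rw [inj_proj_of_ne _ hac, zero_comp, h a hac]
  rw [homSum_eq, this, ← Category.assoc, diag_proj, Category.id_comp]

/-- Two operations on families of parallel morphisms that are natural in the codomain agree as
soon as they agree on families with a single nonzero term, which is an identity. -/
theorem eq_of_natural {M : Type v} {X : C} (L L' : ∀ {Y : C}, (M → (X ⟶ Y)) → (X ⟶ Y))
    (hL : ∀ {Y Z : C} (r : M → (X ⟶ Y)) (g : Y ⟶ Z), L r ≫ g = L (fun a => r a ≫ g))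
    (hL' : ∀ {Y Z : C} (r : M → (X ⟶ Y)) (g : Y ⟶ Z), L' r ≫ g = L' (fun a => r a ≫ g))
    (h : ∀ (c : M) (d : M → (X ⟶ X)), d c = 𝟙 X → (∀ a, a ≠ c → d a = 0) → L d = L' d)
    {Y : C} (r : M → (X ⟶ Y)) : L r = L' r := by
  let b := daggerBiprod (fun _ : M => X)
  -- The injections are the universal family: every family is obtained from them by composing with a
  -- morphism out of the biproduct. Projecting to a factor leaves a single identity among zeros.
  have key : L b.inj = L' b.inj := by
    apply b.lift_ext
    intro c
    rw [hL, hL']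
    exact h c _ (b.inj_self c) (fun a hac => b.inj_proj_of_ne hac)
  have hr : r = fun a => b.inj a ≫ Cofan.IsColimit.desc b.isColimit r :=
    funext fun a => (inj_desc b r a).symm
  rw [hr, ← hL, ← hL', key]

theorem homAdd_comp {X Y Z : C} (r s : X ⟶ Y) (g : Y ⟶ Z) :
    homAdd r s ≫ g = homAdd (r ≫ g) (s ≫ g) := by
  unfold homAdd
  rw [homSum_comp]
  congr 1
  funext i
  split_ifs <;> rfl

theorem comp_homAdd {X Y Z : C} (g : Z ⟶ X) (r s : X ⟶ Y) :
    g ≫ homAdd r s = homAdd (g ≫ r) (g ≫ s) := by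
  unfold homAdd
  rw [comp_homSum]
  congr 1
  funext i
  split_ifs <;> rfl

theorem dagger_homAdd {X Y : C} (r s : X ⟶ Y) :
    dagger (homAdd r s) = homAdd (dagger r) (dagger s) := by
  unfold homAdd
  rw [dagger_homSum]
  congr 1
  funext i
  split_ifs <;> rfl

theorem homAdd_zero {X Y : C} (r : X ⟶ Y) : homAdd r 0 = r := by
  unfold homAdd
  rw [homSum_eq_single _ ⟨true⟩]
  · simp
  · rintro ⟨_ | _⟩ h
    · simp
    · exact absurd rfl h

theorem zero_homAdd {X Y : C} (r : X ⟶ Y) : homAdd 0 r = r := by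
  unfold homAdd
  rw [homSum_eq_single _ ⟨false⟩]
  · simp
  · rintro ⟨_ | _⟩ h
    · exact absurd rfl h
    · simp

theorem homSum_zero {M : Type v} {X Y : C} : homSum (fun _ : M => (0 : X ⟶ Y)) = 0 := by
  have h := homSum_comp (fun _ : M => (0 : X ⟶ X)) (0 : X ⟶ Y)
  simp only [comp_zero] at h
  exact h.symm

theorem homSum_equiv {M N : Type v} {X Y : C} (e : M ≃ N) (r : N → (X ⟶ Y)) :
    homSum (fun a => r (e a)) = homSum r := by
  refine eq_of_natural (fun r => homSum (fun a => r (e a))) (fun r => homSum r)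
    (fun r g => homSum_comp _ _) (fun r g => homSum_comp _ _) (fun c d hc hd => ?_) r
  show homSum (fun a => d (e a)) = homSum d
  rw [homSum_eq_single d c hd, homSum_eq_single _ (e.symm c), e.apply_symm_apply]
  intro a ha
  exact hd _ fun h => ha (by rw [← h, e.symm_apply_apply])

theorem homAdd_homSum_succ {X Y : C} (r : ULift.{v} ℕ → (X ⟶ Y)) :
    homAdd (r ⟨0⟩) (homSum (fun n : ULift.{v} ℕ => r ⟨n.down + 1⟩)) = homSum r := by
  refine eq_of_natural
    (fun r => homAdd (r ⟨0⟩) (homSum (fun n : ULift.{v} ℕ => r ⟨n.down + 1⟩)))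
    (fun r => homSum r) (fun r g => ?_) (fun r g => homSum_comp _ _) (fun c d hc hd => ?_) r
  · simp only [homAdd_comp, homSum_comp]
  · show homAdd (d ⟨0⟩) (homSum (fun n : ULift.{v} ℕ => d ⟨n.down + 1⟩)) = homSum d
    rw [homSum_eq_single d c hd]
    obtain ⟨_ | n⟩ := c
    · have : (fun n : ULift.{v} ℕ => d ⟨n.down + 1⟩) = fun _ => 0 :=
        funext fun n => hd _ (by simp)
      rw [this, homSum_zero, homAdd_zero]
    · rw [hd ⟨0⟩ (by simp), zero_homAdd, homSum_eq_single _ ⟨n⟩]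
      rintro ⟨m⟩ hm
      exact hd _ (by simpa using hm)

theorem homAdd_homSum_even_odd {X Y : C} (r : ULift.{v} ℕ → (X ⟶ Y)) :
    homAdd (homSum (fun n : ULift.{v} ℕ => r ⟨2 * n.down⟩))
      (homSum (fun n : ULift.{v} ℕ => r ⟨2 * n.down + 1⟩)) = homSum r := by
  refine eq_of_natural
    (fun r => homAdd (homSum (fun n : ULift.{v} ℕ => r ⟨2 * n.down⟩))
      (homSum (fun n : ULift.{v} ℕ => r ⟨2 * n.down + 1⟩)))
    (fun r => homSum r) (fun r g => ?_) (fun r g => homSum_comp _ _) (fun c d hc hd => ?_) r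
  · simp only [homAdd_comp, homSum_comp]
  · show homAdd (homSum (fun n : ULift.{v} ℕ => d ⟨2 * n.down⟩))
      (homSum (fun n : ULift.{v} ℕ => d ⟨2 * n.down + 1⟩)) = homSum d
    rw [homSum_eq_single d c hd]
    obtain ⟨c⟩ := c
    obtain ⟨n, rfl | rfl⟩ := Nat.even_or_odd' c
    · have : (fun n : ULift.{v} ℕ => d ⟨2 * n.down + 1⟩) = fun _ => 0 :=
        funext fun m => hd _ (by simp only [ne_eq, ULift.up.injEq]; omega)
      rw [this, homSum_zero, homAdd_zero, homSum_eq_single _ ⟨n⟩]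
      rintro ⟨m⟩ hm
      exact hd _ (by simpa using hm)
    · have : (fun n : ULift.{v} ℕ => d ⟨2 * n.down⟩) = fun _ => 0 :=
        funext fun m => hd _ (by simp only [ne_eq, ULift.up.injEq]; omega)
      rw [this, homSum_zero, zero_homAdd, homSum_eq_single _ ⟨n⟩]
      rintro ⟨m⟩ hm
      exact hd _ (by simpa using hm)

/-- Once addition is idempotent, each term lies below the sum, so a vanishing sum has only vanishing
terms. -/
theorem homAdd_homSum_of_idempotent {M : Type v} {X Y : C} (hX : homAdd (𝟙 X) (𝟙 X) = 𝟙 X)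
    (r : M → (X ⟶ Y)) (c : M) : homAdd (r c) (homSum r) = homSum r := by
  refine eq_of_natural (fun r => homAdd (r c) (homSum r)) (fun r => homSum r)
    (fun r g => ?_) (fun r g => homSum_comp _ _) (fun a d ha hd => ?_) r
  · simp only [homAdd_comp, homSum_comp]
  · show homAdd (d c) (homSum d) = homSum d
    rw [homSum_eq_single d a hd]
    by_cases hca : c = a
    · rw [hca, ha, hX]
    · rw [hd c hca, zero_homAdd]

end Sums

/-! ### The scalars are 0 and 1 -/

section Scalars

variable {C : Type u} [Category.{v} C] [MonoidalCategory C] [DaggerCategory C]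
  [HasDaggerBiproducts C]

/-- The sum w of countably many copies of 1 absorbs 1 and satisfies w + w = w. It is nonzero, since
otherwise 1 + w = w would give 1 = 0. Cancelling the invertible w from w(1 + 1) = w yields 1 + 1 =
1. -/
theorem homAdd_id_of_scalars (hI : ¬ IsZero (𝟙_ C))
    (hinv : ∀ f : 𝟙_ C ⟶ 𝟙_ C, f ≠ 0 → IsIso f) :
    homAdd (𝟙 (𝟙_ C)) (𝟙 (𝟙_ C)) = 𝟙 (𝟙_ C) := by
  let w : 𝟙_ C ⟶ 𝟙_ C := homSum (fun _ : ULift.{v} ℕ => 𝟙 (𝟙_ C))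
  have h1 : homAdd (𝟙 (𝟙_ C)) w = w := homAdd_homSum_succ (fun _ : ULift.{v} ℕ => 𝟙 (𝟙_ C))
  have h2 : homAdd w w = w := homAdd_homSum_even_odd (fun _ : ULift.{v} ℕ => 𝟙 (𝟙_ C))
  have hw : w ≠ 0 := by
    intro h
    rw [h, homAdd_zero] at h1
    exact hI ((IsZero.iff_id_eq_zero _).2 h1)
  have := hinv w hw
  rw [← cancel_epi w, comp_homAdd, Category.comp_id, h2]

theorem homSum_eq_zero_iff_of_scalars (hI : ¬ IsZero (𝟙_ C))
    (hinv : ∀ f : 𝟙_ C ⟶ 𝟙_ C, f ≠ 0 → IsIso f) {M : Type v} {Y : C} (r : M → (𝟙_ C ⟶ Y)) :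
    homSum r = 0 ↔ ∀ a, r a = 0 := by
  constructor
  · intro h a
    have := homAdd_homSum_of_idempotent (homAdd_id_of_scalars hI hinv) r a
    rwa [h, homAdd_zero] at this
  · intro h
    rw [show r = fun _ => 0 from funext h, homSum_zero]

/-- Multiplication by s permutes the nonzero scalars, so their sum t satisfies ts = t. As t is
nonzero, it is invertible and can be cancelled. -/
theorem scalar_eq_id (hI : ¬ IsZero (𝟙_ C))
    (hinv : ∀ f : 𝟙_ C ⟶ 𝟙_ C, f ≠ 0 → IsIso f) (s : 𝟙_ C ⟶ 𝟙_ C) (hs : s ≠ 0) :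
    s = 𝟙 (𝟙_ C) := by
  let t : 𝟙_ C ⟶ 𝟙_ C := homSum (fun a : {f : 𝟙_ C ⟶ 𝟙_ C // f ≠ 0} => a.1)
  have := hinv s hs
  have ht : t ≠ 0 := fun h => hs ((homSum_eq_zero_iff_of_scalars hI hinv _).1 h ⟨s, hs⟩)
  let e : {f : 𝟙_ C ⟶ 𝟙_ C // f ≠ 0} ≃ {f : 𝟙_ C ⟶ 𝟙_ C // f ≠ 0} :=
    { toFun := fun f => ⟨f.1 ≫ s, fun h => f.2 (by rw [← cancel_mono s, h, zero_comp])⟩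
      invFun := fun f => ⟨f.1 ≫ inv s, fun h => f.2 (by rw [← cancel_mono (inv s), h, zero_comp])⟩
      left_inv := fun f => by simp
      right_inv := fun f => by simp }
  have hts : t ≫ s = t := by
    rw [homSum_comp]
    exact homSum_equiv e (fun a => a.1)
  have := hinv t ht
  rw [← cancel_epi t, hts, Category.comp_id]

end Scalars

/-- Dagger kernels exist and are jointly epic with their complements, and the tensor unit is a
nonzero separator all of whose nonzero endomorphisms are invertible. -/
structure RelationalAxioms (C : Type u) [Category.{v} C] [MonoidalCategory C] [DaggerCategory C]
    [HasDaggerBiproducts C] : Prop where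
  exists_kernel : ∀ {X Y : C} (f : X ⟶ Y), ∃ (K : C) (k : K ⟶ X), IsDaggerMonic k ∧ IsKernelOf k f
  jointlyEpic : ∀ {K K' X : C} (k : K ⟶ X) (k' : K' ⟶ X),
    IsDaggerKernel k → IsComplement k' k → JointlyEpic k k'
  unit_not_isZero : ¬ IsZero (𝟙_ C)
  isIso_scalar : ∀ f : 𝟙_ C ⟶ 𝟙_ C, f ≠ 0 → IsIso f
  isSeparator_unit : IsSeparator (𝟙_ C)

/-! ### Factoring through kernels -/

section Kernels

variable {C : Type u} [Category.{v} C] [DaggerCategory C] [HasDaggerBiproducts C]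

theorem IsKernelOf.exists_lift {K X Y Z : C} {k : K ⟶ X} {f : X ⟶ Y} (h : IsKernelOf k f)
    (g : Z ⟶ X) (hg : g ≫ f = 0) : ∃ l : Z ⟶ K, l ≫ k = g := by
  obtain ⟨w, ⟨hl⟩⟩ := h
  obtain ⟨l, hl⟩ := KernelFork.IsLimit.lift' hl g hg
  exact ⟨l, hl⟩

end Kernels

/-! ### Order, orthogonality and atoms among points -/

section Points

variable {C : Type u} [Category.{v} C] [MonoidalCategory C] [DaggerCategory C]
  [HasDaggerBiproducts C]

/-- Two points of `X` are not orthogonal. -/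
def Meets {X : C} (x y : 𝟙_ C ⟶ X) : Prop := x ≫ dagger y ≠ 0

theorem Meets.symm {X : C} {x y : 𝟙_ C ⟶ X} (h : Meets x y) : Meets y x := by
  intro h'
  apply h
  rw [← dagger_eq_zero_iff, dagger_comp, dagger_dagger, h']

theorem Meets.ne_zero_left {X : C} {x y : 𝟙_ C ⟶ X} (h : Meets x y) : x ≠ 0 := by
  rintro rfl
  exact h zero_comp

theorem Meets.ne_zero_right {X : C} {x y : 𝟙_ C ⟶ X} (h : Meets x y) : y ≠ 0 :=
  h.symm.ne_zero_left

theorem IsAtomHom.comp_of_inverse {X Y : C} {u : X ⟶ Y} {w : Y ⟶ X} (huw : u ≫ w = 𝟙 X) (hwu : w ≫ u = 𝟙 Y)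
    {x : 𝟙_ C ⟶ X} (hx : IsAtomHom x) : IsAtomHom (x ≫ u) := by
  constructor
  · intro h
    apply hx.1
    rw [← Category.comp_id x, ← huw, ← Category.assoc, h, zero_comp]
  · intro b hb
    have hb' : HomLE (b ≫ w) x := by
      have : homAdd b (x ≫ u) ≫ w = x := by
        rw [show homAdd b (x ≫ u) = x ≫ u from hb, Category.assoc, huw, Category.comp_id]
      rwa [homAdd_comp, Category.assoc, huw, Category.comp_id] at this
    have hb2 : b = (b ≫ w) ≫ u := by rw [Category.assoc, hwu, Category.comp_id]
    rcases hx.2 _ hb' with h | h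
    · left
      rw [hb2, h, zero_comp]
    · right
      rw [hb2, h]

namespace RelationalAxioms

variable (H : RelationalAxioms C)
include H

theorem hom_ext {X Y : C} {f g : X ⟶ Y} (h : ∀ x : 𝟙_ C ⟶ X, x ≫ f = x ≫ g) : f = g :=
  (isSeparator_def _).1 H.isSeparator_unit f g h

theorem scalar_eq_id {s : 𝟙_ C ⟶ 𝟙_ C} (h : s ≠ 0) : s = 𝟙 (𝟙_ C) :=
  DaggerCategory.scalar_eq_id H.unit_not_isZero H.isIso_scalar s h

theorem id_ne_zero : 𝟙 (𝟙_ C) ≠ 0 := fun h => H.unit_not_isZero ((IsZero.iff_id_eq_zero _).2 h)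

/-- With only two scalars, equations between scalars become equivalences of propositions. -/
theorem scalar_eq {s t : 𝟙_ C ⟶ 𝟙_ C} (h : s ≠ 0 ↔ t ≠ 0) : s = t := by
  by_cases hs : s = 0
  · rw [hs, not_not.1 fun ht => h.2 ht hs]
  · rw [H.scalar_eq_id hs, H.scalar_eq_id (h.1 hs)]

theorem scalar_comp_ne_zero {s t : 𝟙_ C ⟶ 𝟙_ C} : s ≫ t ≠ 0 ↔ s ≠ 0 ∧ t ≠ 0 := by
  constructor
  · intro h
    exact ⟨fun hs => h (by rw [hs, zero_comp]), fun ht => h (by rw [ht, comp_zero])⟩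
  · rintro ⟨hs, ht⟩
    rw [H.scalar_eq_id hs, H.scalar_eq_id ht, Category.comp_id]
    exact H.id_ne_zero

theorem meets_iff {X : C} {x y : 𝟙_ C ⟶ X} : Meets x y ↔ x ≫ dagger y = 𝟙 (𝟙_ C) :=
  ⟨H.scalar_eq_id, fun h => by rw [Meets, h]; exact H.id_ne_zero⟩

theorem homSum_ne_zero {M : Type v} {Y : C} (r : M → (𝟙_ C ⟶ Y)) :
    homSum r ≠ 0 ↔ ∃ a, r a ≠ 0 := by
  rw [ne_eq, homSum_eq_zero_iff_of_scalars H.unit_not_isZero H.isIso_scalar, not_forall]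

theorem homSum_comp_ne_zero {M : Type v} {Y Z : C} (r : M → (𝟙_ C ⟶ Y)) (g : Y ⟶ Z) :
    homSum r ≫ g ≠ 0 ↔ ∃ a, r a ≫ g ≠ 0 := by
  rw [homSum_comp, H.homSum_ne_zero]

theorem meets_homSum {M : Type v} {Y : C} (r : M → (𝟙_ C ⟶ Y)) (z : 𝟙_ C ⟶ Y) :
    Meets (homSum r) z ↔ ∃ a, Meets (r a) z :=
  H.homSum_comp_ne_zero r _

theorem homAdd_ne_zero {Y : C} (r s : 𝟙_ C ⟶ Y) : homAdd r s ≠ 0 ↔ r ≠ 0 ∨ s ≠ 0 := by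
  unfold homAdd
  rw [H.homSum_ne_zero]
  constructor
  · rintro ⟨⟨_ | _⟩, h⟩
    · exact Or.inr h
    · exact Or.inl h
  · rintro (h | h)
    · exact ⟨⟨true⟩, h⟩
    · exact ⟨⟨false⟩, h⟩

theorem dagger_ext {X Y : C} {f g : X ⟶ Y} (h : ∀ y : 𝟙_ C ⟶ Y, f ≫ dagger y = g ≫ dagger y) :
    f = g := by
  apply dagger_injective
  apply H.hom_ext
  intro y
  apply dagger_injective
  rw [dagger_comp, dagger_comp, dagger_dagger, dagger_dagger, h]

/-- The equation x + y = y can be tested against daggers of points, where both sides are scalars and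
a sum is nonzero exactly when a term is. -/
theorem homLE_of_meets {X : C} {x y : 𝟙_ C ⟶ X} (h : ∀ z, Meets x z → Meets y z) : HomLE x y := by
  refine H.dagger_ext fun z => H.scalar_eq ?_
  rw [homAdd_comp, H.homAdd_ne_zero]
  exact ⟨fun h' => h'.elim (h z) id, Or.inr⟩

theorem comp_ne_zero_of_homLE {X Y : C} {x y : 𝟙_ C ⟶ X} (h : HomLE x y) (g : X ⟶ Y)
    (hx : x ≫ g ≠ 0) : y ≫ g ≠ 0 := by
  rw [← show homAdd x y = y from h, homAdd_comp, H.homAdd_ne_zero]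
  exact Or.inl hx

theorem homLE_iff {X : C} {x y : 𝟙_ C ⟶ X} : HomLE x y ↔ ∀ z, Meets x z → Meets y z :=
  ⟨fun h _ hz => H.comp_ne_zero_of_homLE h _ hz, H.homLE_of_meets⟩

theorem eq_of_meets {X : C} {x y : 𝟙_ C ⟶ X} (h : ∀ z, Meets x z ↔ Meets y z) : x = y :=
  H.dagger_ext fun z => H.scalar_eq (h z)

theorem homLE_antisymm {X : C} {x y : 𝟙_ C ⟶ X} (h : HomLE x y) (h' : HomLE y x) : x = y :=
  H.eq_of_meets fun z => ⟨H.homLE_iff.1 h z, H.homLE_iff.1 h' z⟩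

theorem homLE_trans {X : C} {x y z : 𝟙_ C ⟶ X} (h : HomLE x y) (h' : HomLE y z) : HomLE x z :=
  H.homLE_iff.2 fun w hw => H.homLE_iff.1 h' w (H.homLE_iff.1 h w hw)

theorem meets_mono {X : C} {x y x' y' : 𝟙_ C ⟶ X} (hx : HomLE x x') (hy : HomLE y y')
    (h : Meets x y) : Meets x' y' :=
  (H.homLE_iff.1 hy _ (H.homLE_iff.1 hx _ h).symm).symm

/-- If x† ∘ x = 0, then x factors through the kernel of x†, to which it is also orthogonal. -/
theorem meets_self {X : C} {x : 𝟙_ C ⟶ X} (hx : x ≠ 0) : Meets x x := by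
  intro h
  obtain ⟨K, k, hk, hkx⟩ := H.exists_kernel (dagger x)
  obtain ⟨u, rfl⟩ := hkx.exists_lift x h
  have hu : dagger (k ≫ dagger (u ≫ k)) = u := by
    rw [dagger_comp, dagger_dagger, Category.assoc, show k ≫ dagger k = 𝟙 K from hk,
      Category.comp_id]
  have : u = 0 := by
    rw [← hu, hkx.choose, dagger_zero]
  exact hx (by rw [this, zero_comp])

/-- Two points that are not orthogonal have a nonzero common lower bound. -/
theorem exists_homLE_of_meets {X : C} {x y : 𝟙_ C ⟶ X} (h : Meets x y) :
    ∃ z, z ≠ 0 ∧ HomLE z x ∧ HomLE z y := by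
  obtain ⟨K, k, hk, hkx⟩ := H.exists_kernel (dagger x)
  obtain ⟨K', k', hk', hkk'⟩ := H.exists_kernel (dagger k)
  have hkx0 : k ≫ dagger x = 0 := hkx.choose
  have hkk'0 : k' ≫ dagger k = 0 := hkk'.choose
  have hk'k0 : k ≫ dagger k' = 0 := by
    rw [← dagger_eq_zero_iff, dagger_comp, dagger_dagger, hkk'0]
  -- Joint epicness makes the projections onto k and its complement add up to the identity. The
  -- common lower bound is the projection of y onto the complement.
  have hid : homAdd (dagger k ≫ k) (dagger k' ≫ k') = 𝟙 X := by
    apply H.jointlyEpic k k' ⟨hk, _, _, hkx⟩ ⟨hk', hkk'⟩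
    · rw [comp_homAdd, ← Category.assoc, ← Category.assoc, show k ≫ dagger k = 𝟙 K from hk, hk'k0,
        zero_comp, homAdd_zero, Category.id_comp, Category.comp_id]
    · rw [comp_homAdd, ← Category.assoc, ← Category.assoc, show k' ≫ dagger k' = 𝟙 K' from hk',
        hkk'0, zero_comp, zero_homAdd, Category.id_comp, Category.comp_id]
  have hy : y = homAdd (y ≫ dagger k ≫ k) (y ≫ dagger k' ≫ k') := by
    rw [← comp_homAdd, hid, Category.comp_id]
  have hzx : Meets (y ≫ dagger k' ≫ k') x := by
    have := h.symm
    rw [Meets, hy, homAdd_comp, H.homAdd_ne_zero] at this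
    refine this.resolve_left fun h0 => h0 ?_
    simp only [Category.assoc, hkx0, comp_zero]
  refine ⟨y ≫ dagger k' ≫ k', hzx.ne_zero_left, H.homLE_iff.2 fun w hw => ?_,
    H.homLE_iff.2 fun w hw => ?_⟩
  -- A point orthogonal to x factors through k, hence is orthogonal to anything in the image of k'.
  · by_contra hxw
    have hwx : w ≫ dagger x = 0 := not_not.1 fun hwx => hxw (Meets.symm hwx)
    obtain ⟨g, rfl⟩ := hkx.exists_lift w hwx
    apply hw
    rw [dagger_comp]
    simp only [Category.assoc]
    rw [reassoc_of% hkk'0, zero_comp, comp_zero, comp_zero]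
  · rw [Meets, hy, homAdd_comp, H.homAdd_ne_zero]
    exact Or.inr hw

theorem eq_of_meets_of_isAtomHom {X : C} {x y : 𝟙_ C ⟶ X} (hx : IsAtomHom x) (hy : IsAtomHom y)
    (h : Meets x y) : x = y := by
  obtain ⟨z, hz, hzx, hzy⟩ := H.exists_homLE_of_meets h
  rw [← (hx.2 z hzx).resolve_left hz, ← (hy.2 z hzy).resolve_left hz]

theorem meets_iff_eq {X : C} {x y : 𝟙_ C ⟶ X} (hx : IsAtomHom x) (hy : IsAtomHom y) :
    Meets x y ↔ x = y :=
  ⟨H.eq_of_meets_of_isAtomHom hx hy, by rintro rfl; exact H.meets_self hx.1⟩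

theorem isAtomHom_id : IsAtomHom (𝟙 (𝟙_ C)) :=
  ⟨H.id_ne_zero, fun _ _ => or_iff_not_imp_left.2 H.scalar_eq_id⟩

/-- A nonzero point that is not an atom contains two nonzero orthogonal points. -/
theorem exists_orthogonal_of_not_atom {X : C} {x : 𝟙_ C ⟶ X} (hx : x ≠ 0) (h : ¬ IsAtomHom x) :
    ∃ y z, y ≠ 0 ∧ z ≠ 0 ∧ HomLE y x ∧ HomLE z x ∧ ¬ Meets y z := by
  have : ∃ y, HomLE y x ∧ y ≠ 0 ∧ y ≠ x := by
    by_contra h'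
    push Not at h'
    exact h ⟨hx, fun b hb => or_iff_not_imp_left.2 (h' b hb)⟩
  obtain ⟨y, hyx, hy, hne⟩ := this
  -- Since y is strictly below x, some w tells them apart. A common lower bound of x and w is then
  -- orthogonal to y.
  have : ∃ w, Meets x w ∧ ¬ Meets y w := by
    by_contra h'
    push Not at h'
    exact hne (H.homLE_antisymm hyx (H.homLE_iff.2 h'))
  obtain ⟨w, hxw, hyw⟩ := this
  obtain ⟨z, hz, hzx, hzw⟩ := H.exists_homLE_of_meets hxw
  exact ⟨y, z, hy, hz, hyx, hzx, fun h => hyw (H.meets_mono (H.homLE_iff.2 fun _ => id) hzw h)⟩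

theorem homLE_refl {X : C} (x : 𝟙_ C ⟶ X) : HomLE x x := H.homLE_iff.2 fun _ => id

end RelationalAxioms

end Points

/-! ### Tensors of points, and points of the dual -/

section Coherence

variable {C : Type u} [Category.{v} C] [MonoidalCategory C]

theorem tensorPoint_eq_left {X Y : C} (x : 𝟙_ C ⟶ X) (y : 𝟙_ C ⟶ Y) :
    tensorPoint x y = y ≫ (λ_ Y).inv ≫ x ▷ Y := by
  rw [tensorPoint, leftUnitor_inv_naturality_assoc, MonoidalCategory.whisker_exchange,
    ← MonoidalCategory.tensorHom_def]

theorem tensorPoint_eq_right {X Y : C} (x : 𝟙_ C ⟶ X) (y : 𝟙_ C ⟶ Y) :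
    tensorPoint x y = x ≫ (ρ_ X).inv ≫ X ◁ y := by
  rw [tensorPoint, rightUnitor_inv_naturality_assoc, MonoidalCategory.tensorHom_def,
    unitors_inv_equal]

theorem tensorPoint_comp {X Y X' Y' : C} (x : 𝟙_ C ⟶ X) (y : 𝟙_ C ⟶ Y) (f : X ⟶ X')
    (g : Y ⟶ Y') : tensorPoint x y ≫ (f ⊗ₘ g) = tensorPoint (x ≫ f) (y ≫ g) := by
  rw [tensorPoint, tensorPoint, Category.assoc, tensorHom_comp_tensorHom]

theorem tensorPoint_scalar (s t : 𝟙_ C ⟶ 𝟙_ C) :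
    tensorPoint s t ≫ (λ_ (𝟙_ C)).hom = t ≫ s := by
  rw [tensorPoint_eq_left, Category.assoc, Category.assoc, unitors_equal, rightUnitor_naturality,
    ← unitors_equal, Iso.inv_hom_id_assoc]

theorem tensorPoint_associator {X Y Z : C} (x : 𝟙_ C ⟶ X) (y : 𝟙_ C ⟶ Y) (z : 𝟙_ C ⟶ Z) :
    tensorPoint (tensorPoint x y) z ≫ (α_ X Y Z).hom = tensorPoint x (tensorPoint y z) := by
  simp only [tensorPoint, MonoidalCategory.tensorHom_def]
  simp [unitors_inv_equal]

theorem tensorPoint_leftUnitor {X : C} (x : 𝟙_ C ⟶ X) :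
    tensorPoint (𝟙 _) x ≫ (λ_ X).hom = x := by
  simp [tensorPoint_eq_left]

theorem tensorPoint_rightUnitor {X : C} (x : 𝟙_ C ⟶ X) :
    tensorPoint x (𝟙 _) ≫ (ρ_ X).hom = x := by
  simp [tensorPoint_eq_right]

theorem tensorPoint_braiding [SymmetricCategory C] {X Y : C} (x : 𝟙_ C ⟶ X) (y : 𝟙_ C ⟶ Y) :
    tensorPoint x y ≫ (β_ X Y).hom = tensorPoint y x := by
  rw [tensorPoint, tensorPoint, Category.assoc, BraidedCategory.braiding_naturality,
    braiding_tensorUnit_left]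
  simp [unitors_equal]

/-- The morphism `X ⟶ I` that corresponds to a point of the dual of `X`. -/
def pointToEffect {Xs X : C} [ExactPairing Xs X] (s : 𝟙_ C ⟶ Xs) : X ⟶ 𝟙_ C :=
  (ρ_ X).inv ≫ X ◁ s ≫ ε_ Xs X

theorem comp_pointToEffect {Xs X : C} [ExactPairing Xs X] (s : 𝟙_ C ⟶ Xs) (x : 𝟙_ C ⟶ X) :
    x ≫ pointToEffect s = tensorPoint x s ≫ ε_ Xs X := by
  rw [pointToEffect, tensorPoint_eq_right]
  simp only [Category.assoc]

/-- This is the tensor–hom adjunction of the duality with both variables the unit, up to unitors. -/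
theorem pointToEffect_bijective (Xs X : C) [ExactPairing Xs X] :
    Function.Bijective (pointToEffect : (𝟙_ C ⟶ Xs) → (X ⟶ 𝟙_ C)) := by
  have : (pointToEffect : (𝟙_ C ⟶ Xs) → (X ⟶ 𝟙_ C)) =
      ((Iso.homCongr (Iso.refl (𝟙_ C)) (ρ_ Xs).symm).trans
        (tensorLeftHomEquiv (𝟙_ C) Xs X (𝟙_ C)).symm).trans
        (Iso.homCongr (ρ_ X) (Iso.refl (𝟙_ C))) := by
    funext s
    simp [pointToEffect, tensorLeftHomEquiv, unitors_equal]
  rw [this]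
  exact Equiv.bijective _

end Coherence

/-! ### Scalar products of tensors -/

section CompactClosed

variable {C : Type u} [Category.{v} C] [MonoidalCategory C] [SymmetricCategory C]
  [DaggerCategory C] [DaggerCompactClosed C]

theorem tensorPoint_comp_dagger {X Y : C} (x x' : 𝟙_ C ⟶ X) (y y' : 𝟙_ C ⟶ Y) :
    tensorPoint x y ≫ dagger (tensorPoint x' y') = (y ≫ dagger y') ≫ (x ≫ dagger x') := by
  have : dagger (tensorPoint x' y') = (dagger x' ⊗ₘ dagger y') ≫ (λ_ (𝟙_ C)).hom := by
    rw [tensorPoint, dagger_comp, DaggerSymmetricMonoidal.dagger_tensor,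
      ← DaggerSymmetricMonoidal.dagger_leftUnitor, dagger_dagger]
  rw [this, ← Category.assoc, tensorPoint_comp, tensorPoint_scalar]

theorem exists_exactPairing (X : C) : ∃ Xs : C, Nonempty (ExactPairing Xs X) :=
  let ⟨Xs, p, _⟩ := DaggerCompactClosed.hasDaggerDual X
  ⟨Xs, ⟨p⟩⟩

end CompactClosed

/-! ### Existence of atoms, and atoms of tensor products -/

section Tensor

variable {C : Type u} [Category.{v} C] [MonoidalCategory C] [DaggerCategory C]
  [HasDaggerBiproducts C]

theorem meets_comp_right {X Y : C} (x : 𝟙_ C ⟶ Y) (y : 𝟙_ C ⟶ X) (f : X ⟶ Y) :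
    Meets x (y ≫ f) ↔ Meets (x ≫ dagger f) y := by
  rw [Meets, Meets, dagger_comp, Category.assoc]

namespace RelationalAxioms

variable (H : RelationalAxioms C)
include H

theorem comp_meets_iff {X Y : C} (x : 𝟙_ C ⟶ X) (f : X ⟶ Y) (y : 𝟙_ C ⟶ Y) :
    Meets (x ≫ f) y ↔ x ≫ f ≫ dagger y = 𝟙 (𝟙_ C) := by
  rw [H.meets_iff, Category.assoc]

theorem homLE_of_meets_atom {X : C} {a x : 𝟙_ C ⟶ X} (ha : IsAtomHom a) (h : Meets a x) :
    HomLE a x := by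
  obtain ⟨z, hz, hza, hzx⟩ := H.exists_homLE_of_meets h
  rwa [(ha.2 z hza).resolve_left hz] at hzx

/-- Transposing X to the other side makes the separator property available for Y; transposing back
makes it available for X. -/
theorem tensor_hom_ext {Xs X Y Z : C} (p : ExactPairing Xs X) {f g : X ⊗ Y ⟶ Z}
    (h : ∀ (x : 𝟙_ C ⟶ X) (y : 𝟙_ C ⟶ Y), tensorPoint x y ≫ f = tensorPoint x y ≫ g) :
    f = g := by
  apply (tensorLeftHomEquiv Y Xs X Z).injective
  apply H.hom_ext
  intro y
  apply (tensorLeftHomEquiv (𝟙_ C) Xs X Z).symm.injective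
  rw [tensorLeftHomEquiv_symm_naturality, tensorLeftHomEquiv_symm_naturality,
    Equiv.symm_apply_apply, Equiv.symm_apply_apply, ← cancel_epi (ρ_ X).inv]
  apply H.hom_ext
  intro x
  simpa only [tensorPoint_eq_right, Category.assoc] using h x y

/-- The passage from points of the dual to points of X is bijective and additive, so it preserves
and reflects the order. -/
theorem homLE_pointToEffect {Xs X : C} [ExactPairing Xs X] (s t : 𝟙_ C ⟶ Xs) :
    HomLE (dagger (pointToEffect s : X ⟶ 𝟙_ C)) (dagger (pointToEffect t : X ⟶ 𝟙_ C)) ↔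
      HomLE s t := by
  have hadd : (pointToEffect (homAdd s t) : X ⟶ 𝟙_ C) =
      homAdd (pointToEffect s) (pointToEffect t) := by
    apply H.hom_ext
    intro x
    rw [comp_homAdd, comp_pointToEffect, comp_pointToEffect, comp_pointToEffect,
      tensorPoint_eq_left, tensorPoint_eq_left, tensorPoint_eq_left, homAdd_comp, homAdd_comp]
  unfold HomLE
  rw [← dagger_homAdd, ← hadd]
  constructor
  · intro h
    exact (pointToEffect_bijective Xs X).1 (dagger_injective h)
  · intro h
    rw [h]

end RelationalAxioms

variable [SymmetricCategory C] [DaggerCompactClosed C]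

namespace RelationalAxioms

variable (H : RelationalAxioms C)
include H

theorem meets_tensorPoint {X Y : C} {x x' : 𝟙_ C ⟶ X} {y y' : 𝟙_ C ⟶ Y} :
    Meets (tensorPoint x y) (tensorPoint x' y') ↔ Meets x x' ∧ Meets y y' := by
  rw [Meets, tensorPoint_comp_dagger, H.scalar_comp_ne_zero, and_comm]
  rfl

theorem tensor_homLE {X Y : C} {f g : 𝟙_ C ⟶ X ⊗ Y}
    (h : ∀ (x : 𝟙_ C ⟶ X) (y : 𝟙_ C ⟶ Y), Meets f (tensorPoint x y) → Meets g (tensorPoint x y)) :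
    HomLE f g := by
  obtain ⟨Xs, ⟨p⟩⟩ := exists_exactPairing X
  apply dagger_injective
  refine H.tensor_hom_ext p fun x y => ?_
  apply dagger_injective
  rw [dagger_comp, dagger_comp, dagger_dagger, dagger_dagger, homAdd_comp]
  refine H.scalar_eq ?_
  rw [H.homAdd_ne_zero]
  exact ⟨fun h' => h'.elim (h x y) id, Or.inr⟩

theorem exists_atom_homLE {X : C} {b : 𝟙_ C ⟶ X} (hb : b ≠ 0) :
    ∃ a, IsAtomHom a ∧ HomLE a b := by
  by_contra hatom
  push Not at hatom
  obtain ⟨Xs, ⟨p⟩⟩ := exists_exactPairing X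
  have hsurj : ∀ x : 𝟙_ C ⟶ X, ∃ s : 𝟙_ C ⟶ Xs, dagger (pointToEffect s : X ⟶ 𝟙_ C) = x := by
    intro x
    obtain ⟨s, hs⟩ := (pointToEffect_bijective Xs X).2 (dagger x)
    exact ⟨s, by rw [hs, dagger_dagger]⟩
  have hne : ∀ s : 𝟙_ C ⟶ Xs, dagger (pointToEffect s : X ⟶ 𝟙_ C) ≠ 0 → s ≠ 0 := by
    rintro s hs rfl
    apply hs
    rw [dagger_eq_zero_iff]
    apply H.hom_ext
    intro x
    rw [comp_pointToEffect, tensorPoint_eq_left, zero_comp, zero_comp, comp_zero]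
  -- `e` is the complement of the name of the identity
  let e : 𝟙_ C ⟶ X ⊗ Xs :=
    homSum (fun q : {q : (𝟙_ C ⟶ X) × (𝟙_ C ⟶ Xs) // tensorPoint q.1 q.2 ≫ ε_ Xs X = 0} =>
      tensorPoint q.1.1 q.1.2)
  have he : e ≫ ε_ Xs X = 0 := by
    by_contra h
    obtain ⟨q, hq⟩ := (H.homSum_comp_ne_zero _ _).1 h
    exact hq q.2
  have hmem : ∀ (y y' : 𝟙_ C ⟶ X) (s s' : 𝟙_ C ⟶ Xs),
      ¬ Meets y (dagger (pointToEffect s : X ⟶ 𝟙_ C)) → Meets y y' → Meets s s' →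
        Meets e (tensorPoint y' s') := by
    intro y y' s s' h0 hy hs
    refine (H.meets_homSum _ _).2 ⟨⟨(y, s), ?_⟩, H.meets_tensorPoint.2 ⟨hy, hs⟩⟩
    rw [Meets, dagger_dagger, not_not] at h0
    rwa [← comp_pointToEffect]
  obtain ⟨sb, hsb⟩ := hsurj b
  have hle : HomLE (tensorPoint b sb) e := by
    -- Below both the conjugate of b and s' lies some t, whose point of X is below b. It is not an
    -- atom, so it contains orthogonal x₁ and x₂, whose conjugates s₁ and s₂ both meet s'.
    refine H.tensor_homLE fun y' s' h => ?_
    obtain ⟨hby, hss⟩ := H.meets_tensorPoint.1 h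
    obtain ⟨t, ht, htb, hts⟩ := H.exists_homLE_of_meets hss
    rw [← H.homLE_pointToEffect (X := X), hsb] at htb
    have ht0 : dagger (pointToEffect t : X ⟶ 𝟙_ C) ≠ 0 := by
      intro h0
      apply ht
      apply (pointToEffect_bijective Xs X).1
      rw [(dagger_eq_zero_iff _).1 h0]
      symm
      apply H.hom_ext
      intro x
      rw [comp_pointToEffect, tensorPoint_eq_left, zero_comp, zero_comp, comp_zero]
    obtain ⟨x₁, x₂, hx₁, hx₂, hx₁t, hx₂t, h12⟩ :=
      H.exists_orthogonal_of_not_atom ht0 fun h => hatom _ h htb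
    obtain ⟨s₁, rfl⟩ := hsurj x₁
    obtain ⟨s₂, rfl⟩ := hsurj x₂
    rw [H.homLE_pointToEffect] at hx₁t hx₂t
    have hs₁ : Meets s₁ s' :=
      H.meets_mono (H.homLE_refl _) (H.homLE_trans hx₁t hts) (H.meets_self (hne _ hx₁))
    have hs₂ : Meets s₂ s' :=
      H.meets_mono (H.homLE_refl _) (H.homLE_trans hx₂t hts) (H.meets_self (hne _ hx₂))
    -- If y' meets x₁, a common lower bound z is orthogonal to x₂, and z ⊗ s₂ is a term of `e`.
    -- Otherwise y' ⊗ s₁ is one.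
    by_cases hy' : Meets y' (dagger (pointToEffect s₁ : X ⟶ 𝟙_ C))
    · obtain ⟨z, hz, hzy, hzs⟩ := H.exists_homLE_of_meets hy'
      refine hmem z y' s₂ s' (fun h => h12 ?_)
        (H.meets_mono (H.homLE_refl _) hzy (H.meets_self hz)) hs₂
      exact H.meets_mono hzs (H.homLE_refl _) h
    · exact hmem y' y' s₁ s' hy' (H.meets_self hby.ne_zero_right) hs₁
  -- The counit sends the tensor of b with its conjugate to b† ∘ b, which is nonzero, but it kills
  -- `e`.
  refine H.comp_ne_zero_of_homLE hle (ε_ Xs X) ?_ he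
  rw [← comp_pointToEffect, ← dagger_dagger (pointToEffect sb), hsb]
  exact H.meets_self hb

theorem exists_atom_of_meets {X : C} {x y : 𝟙_ C ⟶ X} (h : Meets x y) :
    ∃ a, IsAtomHom a ∧ Meets x a ∧ Meets a y := by
  obtain ⟨z, hz, hzx, hzy⟩ := H.exists_homLE_of_meets h
  obtain ⟨a, ha, haz⟩ := H.exists_atom_homLE hz
  have haa := H.meets_self ha.1
  exact ⟨a, ha, H.meets_mono (H.homLE_trans haz hzx) (H.homLE_refl _) haa,
    H.meets_mono (H.homLE_refl _) (H.homLE_trans haz hzy) haa⟩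

theorem isAtomHom_tensorPoint {X Y : C} {x : 𝟙_ C ⟶ X} {y : 𝟙_ C ⟶ Y} (hx : IsAtomHom x)
    (hy : IsAtomHom y) : IsAtomHom (tensorPoint x y) := by
  refine ⟨Meets.ne_zero_left (H.meets_tensorPoint.2 ⟨H.meets_self hx.1, H.meets_self hy.1⟩),
    fun z hz => or_iff_not_imp_left.2 fun hz0 => H.homLE_antisymm hz ?_⟩
  have hmeet : Meets z (tensorPoint x y) :=
    H.meets_mono (H.homLE_refl _) hz (H.meets_self hz0)
  refine H.tensor_homLE fun x' y' h => ?_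
  obtain ⟨h1, h2⟩ := H.meets_tensorPoint.1 h
  -- Atoms lie below what they meet, so x ⊗ y ≤ x' ⊗ y'. Since z meets x ⊗ y, it meets x' ⊗ y' too.
  refine H.meets_mono (H.homLE_refl _) (H.tensor_homLE fun x₀ y₀ h₀ => ?_) hmeet
  obtain ⟨h3, h4⟩ := H.meets_tensorPoint.1 h₀
  exact H.meets_tensorPoint.2 ⟨H.meets_mono (H.homLE_of_meets_atom hx h1) (H.homLE_refl _) h3,
    H.meets_mono (H.homLE_of_meets_atom hy h2) (H.homLE_refl _) h4⟩

theorem exists_eq_tensorPoint {X Y : C} {z : 𝟙_ C ⟶ X ⊗ Y} (hz : IsAtomHom z) :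
    ∃ x y, IsAtomHom x ∧ IsAtomHom y ∧ tensorPoint x y = z := by
  have : ∃ x y, Meets z (tensorPoint x y) := by
    by_contra h
    push Not at h
    have hz0 : HomLE z 0 := H.tensor_homLE fun x y hxy => absurd hxy (h x y)
    rw [HomLE, homAdd_zero] at hz0
    exact hz.1 hz0
  obtain ⟨x, y, hxy⟩ := this
  -- Moving one factor across the dagger leaves a relation between points of Y alone, where y can be
  -- replaced by an atom. The same is then done for x.
  rw [tensorPoint_eq_left, meets_comp_right] at hxy
  obtain ⟨b, hb, hyb, -⟩ := H.exists_atom_of_meets hxy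
  rw [← meets_comp_right, ← tensorPoint_eq_left, tensorPoint_eq_right, meets_comp_right] at hyb
  obtain ⟨a, ha, hxa, -⟩ := H.exists_atom_of_meets hyb
  rw [← meets_comp_right, ← tensorPoint_eq_right] at hxa
  exact ⟨a, b, ha, hb,
    (H.eq_of_meets_of_isAtomHom hz (H.isAtomHom_tensorPoint ha hb) hxa).symm⟩

end RelationalAxioms

end Tensor

end DaggerCategory

/-! ### Composites of graphs of functions -/

namespace RelMon

theorem graph_comp_eq {W X X' Y : RelCat.{v}} {f : El W → El X} {g : El X → El Y}
    {f' : El W → El X'} {g' : El X' → El Y} (h : ∀ w, g (f w) = g' (f' w)) :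
    graphHom f ≫ graphHom g = graphHom f' ≫ graphHom g' := by
  rw [graph_comp, graph_comp, funext h]

theorem graph_eq_comp_comp {W X Y Z : RelCat.{v}} {d : El W → El Z} {f : El W → El X}
    {g : El X → El Y} {k : El Y → El Z} (h : ∀ w, d w = k (g (f w))) :
    graphHom d = graphHom f ≫ graphHom g ≫ graphHom k := by
  rw [graph_comp, graph_comp, funext h]

theorem graph_comp_comp_eq {W X Y X' Y' Z : RelCat.{v}} {f : El W → El X} {g : El X → El Y}
    {k : El Y → El Z} {f' : El W → El X'} {g' : El X' → El Y'} {k' : El Y' → El Z}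
    (h : ∀ w, k (g (f w)) = k' (g' (f' w))) :
    graphHom f ≫ graphHom g ≫ graphHom k = graphHom f' ≫ graphHom g' ≫ graphHom k' := by
  rw [graph_comp, graph_comp, graph_comp, graph_comp, funext h]

end RelMon

namespace DaggerCategory

/-! ### The functor E and its monoidal structure -/

section Functor

variable {C : Type u} [Category.{v} C] [MonoidalCategory C] [DaggerCategory C]
  [HasDaggerBiproducts C]

theorem atom_ext {X : C} {x y : RelMon.El (atomObj X)} (h : atomPoint x = atomPoint y) : x = y :=
  Subtype.ext h

theorem isAtomHom_atomPoint {X : C} (x : RelMon.El (atomObj X)) : IsAtomHom (atomPoint x) := x.2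

namespace RelationalAxioms

variable (H : RelationalAxioms C)
include H

theorem related_atomMap {X Y : C} (f : X ⟶ Y) (x : RelMon.El (atomObj X))
    (y : RelMon.El (atomObj Y)) :
    RelMon.Related (atomMap f) x y ↔ Meets (atomPoint x ≫ f) (atomPoint y) :=
  (H.comp_meets_iff _ _ _).symm

theorem atomMap_id (X : C) : atomMap (𝟙 X) = 𝟙 (atomObj X) := by
  apply RelMon.hom_ext
  intro x y
  rw [H.related_atomMap, RelMon.related_id, Category.comp_id,
    H.meets_iff_eq (isAtomHom_atomPoint x) (isAtomHom_atomPoint y)]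
  exact ⟨atom_ext, fun h => by rw [h]⟩

/-- On an isomorphism, `E` is the graph of composition. -/
theorem atomMap_iso_hom {X Y : C} (f : X ≅ Y) :
    atomMap f.hom = RelMon.graphHom (fun x => mkAtom (atomPoint x ≫ f.hom)
      ((isAtomHom_atomPoint x).comp_of_inverse f.hom_inv_id f.inv_hom_id)) := by
  apply RelMon.hom_ext
  intro x y
  rw [H.related_atomMap, H.meets_iff_eq
    ((isAtomHom_atomPoint x).comp_of_inverse f.hom_inv_id f.inv_hom_id) (isAtomHom_atomPoint y)]
  exact ⟨fun h => (atom_ext h : mkAtom _ _ = y), fun h => congrArg atomPoint h⟩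

theorem unitAtom_bijective : Function.Bijective (unitAtom H.isAtomHom_id) := by
  refine ⟨fun x y _ => rfl, fun y => ⟨PUnit.unit, atom_ext ?_⟩⟩
  exact (H.scalar_eq_id (isAtomHom_atomPoint y).1).symm

variable [SymmetricCategory C] [DaggerCompactClosed C]

/-- The composite relates x to z when r ∘ x meets s† ∘ z, and then they meet at an atom of Y.
Conversely, an atom that meets r ∘ x lies below it. -/
theorem atomMap_comp {X Y Z : C} (r : X ⟶ Y) (s : Y ⟶ Z) :
    atomMap (r ≫ s) = atomMap r ≫ atomMap s := by
  apply RelMon.hom_ext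
  intro x z
  simp only [RelMon.related_comp, H.related_atomMap]
  constructor
  · intro h
    rw [← Category.assoc] at h
    have h' : Meets (atomPoint x ≫ r) (atomPoint z ≫ dagger s) := by
      rwa [meets_comp_right, dagger_dagger]
    obtain ⟨a, ha, h1, h2⟩ := H.exists_atom_of_meets h'
    rw [meets_comp_right, dagger_dagger] at h2
    exact ⟨mkAtom a ha, h1, h2⟩
  · rintro ⟨y, h1, h2⟩
    have h3 := H.homLE_of_meets_atom (isAtomHom_atomPoint y) h1.symm
    have h2' : atomPoint y ≫ (s ≫ dagger (atomPoint z)) ≠ 0 := by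
      rw [← Category.assoc]
      exact h2
    have := H.comp_ne_zero_of_homLE h3 _ h2'
    simpa only [Meets, Category.assoc] using this

theorem isAtomHom_tensor_atomPoint {X Y : C} (x : RelMon.El (atomObj X))
    (y : RelMon.El (atomObj Y)) : IsAtomHom (tensorPoint (atomPoint x) (atomPoint y)) :=
  H.isAtomHom_tensorPoint (isAtomHom_atomPoint x) (isAtomHom_atomPoint y)

/-- Equal tensors of atoms meet, so their factors meet and are therefore equal. -/
theorem tensorAtom_bijective (X Y : C) :
    Function.Bijective (tensorAtom H.isAtomHom_tensor_atomPoint X Y) := by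
  constructor
  · intro p q hpq
    have h : tensorPoint (atomPoint (RelMon.fst p)) (atomPoint (RelMon.snd p)) =
      tensorPoint (atomPoint (RelMon.fst q)) (atomPoint (RelMon.snd q)) := congrArg atomPoint hpq
    have hm := H.meets_self (H.isAtomHom_tensor_atomPoint (RelMon.fst p) (RelMon.snd p)).1
    nth_rw 2 [h] at hm
    obtain ⟨h1, h2⟩ := H.meets_tensorPoint.1 hm
    exact (RelMon.prod_ext p q).2
      ⟨atom_ext (H.eq_of_meets_of_isAtomHom (isAtomHom_atomPoint _) (isAtomHom_atomPoint _) h1),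
        atom_ext (H.eq_of_meets_of_isAtomHom (isAtomHom_atomPoint _) (isAtomHom_atomPoint _) h2)⟩
  · intro z
    obtain ⟨x, y, hx, hy, hz⟩ := H.exists_eq_tensorPoint (isAtomHom_atomPoint z)
    exact ⟨RelMon.pair (mkAtom x hx) (mkAtom y hy), atom_ext hz⟩

theorem atomMap_tensor {X X' Y Y' : C} (f : X ⟶ Y) (g : X' ⟶ Y') :
    RelMon.prodHom (atomMap f) (atomMap g) ≫
        RelMon.graphHom (tensorAtom H.isAtomHom_tensor_atomPoint Y Y') =
      RelMon.graphHom (tensorAtom H.isAtomHom_tensor_atomPoint X X') ≫ atomMap (f ⊗ₘ g) := by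
  refine RelMon.comp_graph_eq _ _ (Equiv.ofBijective _ (H.tensorAtom_bijective X X'))
    (Equiv.ofBijective _ (H.tensorAtom_bijective Y Y')) fun p q => ?_
  rw [H.related_atomMap]
  change RelMon.Related (atomMap f) (RelMon.fst p) (RelMon.fst q) ∧
    RelMon.Related (atomMap g) (RelMon.snd p) (RelMon.snd q) ↔
    Meets (tensorPoint (atomPoint (RelMon.fst p)) (atomPoint (RelMon.snd p)) ≫ (f ⊗ₘ g))
      (tensorPoint (atomPoint (RelMon.fst q)) (atomPoint (RelMon.snd q)))
  rw [H.related_atomMap, H.related_atomMap, tensorPoint_comp, H.meets_tensorPoint]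

/-- `E` as a strong monoidal functor. -/
noncomputable def atomCoreMonoidal :
    (atomFunctor H.atomMap_id H.atomMap_comp).CoreMonoidal where
  εIso := RelMon.equivIso (Equiv.ofBijective _ H.unitAtom_bijective)
  μIso X Y := RelMon.equivIso (Equiv.ofBijective _ (H.tensorAtom_bijective X Y))
  μIso_hom_natural_left {X Y} f X' := by
    have h := H.atomMap_tensor f (𝟙 X')
    rw [H.atomMap_id, tensorHom_id] at h
    exact h
  μIso_hom_natural_right {X Y} X' f := by
    have h := H.atomMap_tensor (𝟙 X') f
    rw [H.atomMap_id, id_tensorHom] at h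
    exact h
  associativity X Y Z := by
    -- E of the associator is also a graph, so the coherence law becomes an equation between
    -- functions, checked on tensors of points.
    change RelMon.prodHom (RelMon.graphHom _) (𝟙 _) ≫ RelMon.graphHom _ ≫ atomMap _ =
      RelMon.graphHom _ ≫ RelMon.prodHom (𝟙 _) (RelMon.graphHom _) ≫ RelMon.graphHom _
    rw [H.atomMap_iso_hom, RelMon.graph_id, RelMon.graph_id, RelMon.prodHom_graph, RelMon.prodHom_graph]
    exact RelMon.graph_comp_comp_eq fun _ => atom_ext (tensorPoint_associator _ _ _)
  left_unitality X := by
    change RelMon.graphHom _ =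
      RelMon.prodHom (RelMon.graphHom _) (𝟙 _) ≫ RelMon.graphHom _ ≫ atomMap _
    rw [H.atomMap_iso_hom, RelMon.graph_id, RelMon.prodHom_graph]
    exact RelMon.graph_eq_comp_comp fun _ => atom_ext (tensorPoint_leftUnitor _).symm
  right_unitality X := by
    change RelMon.graphHom _ =
      RelMon.prodHom (𝟙 _) (RelMon.graphHom _) ≫ RelMon.graphHom _ ≫ atomMap _
    rw [H.atomMap_iso_hom, RelMon.graph_id, RelMon.prodHom_graph]
    exact RelMon.graph_eq_comp_comp fun _ => atom_ext (tensorPoint_rightUnitor _).symm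

theorem atom_braided (X Y : C) :
    RelMon.graphHom (tensorAtom H.isAtomHom_tensor_atomPoint X Y) ≫ atomMap (β_ X Y).hom =
      (RelMon.swapIso (atomObj X) (atomObj Y)).hom ≫
        RelMon.graphHom (tensorAtom H.isAtomHom_tensor_atomPoint Y X) := by
  change RelMon.graphHom _ ≫ atomMap _ = RelMon.graphHom _ ≫ RelMon.graphHom _
  rw [H.atomMap_iso_hom]
  exact RelMon.graph_comp_eq fun _ => atom_ext (tensorPoint_braiding _ _)

/-- `E` as a strong symmetric monoidal functor. -/
@[reducible]
noncomputable def atomFunctorBraided : (atomFunctor H.atomMap_id H.atomMap_comp).Braided :=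
  { H.atomCoreMonoidal.toMonoidal with
    braided := H.atom_braided }

end RelationalAxioms

end Functor

end DaggerCategory

theorem proposition9 {C : Type u} [Category.{v} C] [MonoidalCategory C] [SymmetricCategory C]
    [DaggerCategory C] [DaggerCompactClosed C]
    -- each family of objects has a dagger biproduct
    [HasDaggerBiproducts C]
    -- each morphism has a kernel that is dagger monic
    (hker : ∀ {X Y : C} (f : X ⟶ Y), ∃ (K : C) (k : K ⟶ X), IsDaggerMonic k ∧ IsKernelOf k f)
    -- a dagger kernel and its complement are jointly epic
    (hepi : ∀ {K K' X : C} (k : K ⟶ X) (k' : K' ⟶ X),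
      IsDaggerKernel k → IsComplement k' k → JointlyEpic k k')
    (hI : ¬ IsZero (𝟙_ C))
    (hinv : ∀ f : 𝟙_ C ⟶ 𝟙_ C, f ≠ 0 → IsIso f)
    (hsep : IsSeparator (𝟙_ C)) :
    -- `E` is a functor, and the functions `* ↦ 1` and `(x, y) ↦ x ⊗ y` take values in atoms
    ∃ (hid : ∀ X : C, atomMap (𝟙 X) = 𝟙 (atomObj X))
      (hcomp : ∀ {X Y Z : C} (r : X ⟶ Y) (s : Y ⟶ Z), atomMap (r ≫ s) = atomMap r ≫ atomMap s)
      (hone : IsAtomHom (𝟙 (𝟙_ C)))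
      (htensor : ∀ {X Y : C} (x : RelMon.El (atomObj X)) (y : RelMon.El (atomObj Y)),
        IsAtomHom (tensorPoint (atomPoint x) (atomPoint y))),
      (∀ X Y : C, Function.Bijective (tensorAtom htensor X Y)) ∧
      -- `E` is strong symmetric monoidal with these structure maps
      ∃ _ : (atomFunctor hid hcomp).Braided,
        Functor.LaxMonoidal.ε (atomFunctor hid hcomp) = RelMon.graphHom (unitAtom hone) ∧
        ∀ X Y : C, Functor.LaxMonoidal.μ (atomFunctor hid hcomp) X Y =
          RelMon.graphHom (tensorAtom htensor X Y) := by
  have H : RelationalAxioms C := ⟨hker, hepi, hI, hinv, hsep⟩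
  exact ⟨H.atomMap_id, H.atomMap_comp, H.isAtomHom_id, H.isAtomHom_tensor_atomPoint,
    H.tensorAtom_bijective, H.atomFunctorBraided, rfl, fun _ _ => rfl⟩
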